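/- Linear reconstruction game in dimension $d\ge 1$ with noise level $\delta>0$ and $T$ rounds: an adversary holds a secret point $x^*\in\mathbb{R}^d$. In each round $t=1,\dots,T$ the reconstructor chooses a unit vector $v_t\in\mathbb{R}^d$ (Euclidean norm), possibly depending on the previous answers, and the adversary replies with a number $r_t$ satisfying $|r_t-\langle x^*,v_t\rangle|\le\delta$. After $T$ rounds the reconstructor outputs an estimate $\hat x_T\in\mathbb{R}^d$ depending on the answers. All strategies are deterministic. Let $$\mathrm{OPT}_d(T,\delta)=\inf_{\mathcal R}\ \sup_{x^*\in\mathbb{R}^d}\ \sup_{\mathcal A}\ \|\hat x_T-x^*\|_2\in[0,\infty],$$ where $\mathcal R$ ranges over the reconstruction strategies and $\mathcal A$ over the adversary response strategies consistent with $x^*$ at noise level $\delta$. Let $$\mathrm{OPT}_d(\infty,\delta)=\lim_{T\to\infty}\mathrm{OPT}_d(T,\delta),\qquad \mathsf{ExcessErr}_d(T,\delta)=\mathrm{OPT}_d(T,\delta)-\mathrm{OPT}_d(\infty,\delta).$$ Theorem. Let $\delta>0$ be fixed and let $T:\mathbb{N}\to\mathbb{N}$ be a query budget depending on the dimension $d$.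 1. If $\ln T(d)=o(d)$, i.e. $\frac{\ln T(d)}{d}\to 0$ as $d\to\infty$ (with the convention $\ln 0=0$), then $\mathsf{ExcessErr}_d(T(d),\delta)\to+\infty$ as $d\to\infty$. 2. If $\ln T(d)=\omega(d)$, i.e. $\frac{\ln T(d)}{d}\to+\infty$ as $d\to\infty$, then $\mathsf{ExcessErr}_d(T(d),\delta)\to 0$ as $d\to\infty$. -/

import Mathlib

open Filter Topology
open scoped ENNReal

namespace LinearReconstruction

/-- Unit vectors of Euclidean `ℝ^d`: the admissible query directions. -/
abbrev Direction (d : ℕ) : Type :=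
  Metric.sphere (0 : EuclideanSpace ℝ (Fin d)) 1

/-- A (deterministic) reconstruction strategy in `ℝ^d`. The next query is a function of the list of
answers received so far (in chronological order), and the final estimate is a function of the list
of all answers. In a game of `T` rounds only lists of length `< T` are passed to `query`, and only
lists of length `T` are passed to `output`. -/
structure Reconstructor (d : ℕ) where
  /-- the next query, given the previous answers -/
  query : List ℝ → Direction d
  /-- the estimate that is output, given all answers -/
  output : List ℝ → EuclideanSpace ℝ (Fin d)

/-- A (deterministic) adversary response strategy at noise level `δ` that is consistent with the
secret point `x`. The answer depends on the previous rounds (pairs of a query and its answer, in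
chronological order) and on the current query. -/
structure Adversary (d : ℕ) (δ : ℝ) (x : EuclideanSpace ℝ (Fin d)) where
  /-- the answer, given the past rounds and the current query -/
  answer : List (Direction d × ℝ) → Direction d → ℝ
  /-- every answer is `δ`-accurate -/
  accurate : ∀ (h : List (Direction d × ℝ)) (v : Direction d),
    |answer h v - inner ℝ x (v : EuclideanSpace ℝ (Fin d))| ≤ δ

/-- The transcript of the first `t` rounds of the interaction. -/
def transcript {d : ℕ} {δ : ℝ} {x : EuclideanSpace ℝ (Fin d)} (R : Reconstructor d)
    (A : Adversary d δ x) : ℕ → List (Direction d × ℝ)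
  | 0 => []
  | t + 1 =>
    let h := transcript R A t
    let v := R.query (h.map Prod.snd)
    h ++ [(v, A.answer h v)]

/-- The estimate output by the reconstructor after `T` rounds. -/
def estimate {d : ℕ} {δ : ℝ} {x : EuclideanSpace ℝ (Fin d)} (R : Reconstructor d)
    (A : Adversary d δ x) (T : ℕ) : EuclideanSpace ℝ (Fin d) :=
  R.output ((transcript R A T).map Prod.snd)

/-- The optimal reconstruction error `OPT_d(T, δ)`. It takes values in `[0, ∞]`; it is infinite
when no finite error can be guaranteed, for instance with fewer queries than dimensions. -/
noncomputable def opt (d T : ℕ) (δ : ℝ) : ℝ≥0∞ :=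
  ⨅ R : Reconstructor d, ⨆ x : EuclideanSpace ℝ (Fin d), ⨆ A : Adversary d δ x,
    ‖estimate R A T - x‖ₑ

/-- `OPT_d(∞, δ) = lim_{T → ∞} OPT_d(T, δ)`. -/
noncomputable def optLimit (d : ℕ) (δ : ℝ) : ℝ≥0∞ :=
  limUnder atTop (fun T : ℕ => opt d T δ)

/-- The excess error `OPT_d(T, δ) - OPT_d(∞, δ)`, as an extended real number. -/
noncomputable def excessErr (d T : ℕ) (δ : ℝ) : EReal :=
  (opt d T δ : EReal) - (optLimit d δ : EReal)

theorem length_transcript {d : ℕ} {δ : ℝ} {x : EuclideanSpace ℝ (Fin d)} (R : Reconstructor d)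
    (A : Adversary d δ x) (t : ℕ) : (transcript R A t).length = t := by
  induction t with
  | zero => rfl
  | succ t ih => simp [transcript, ih]

theorem opt_antitone (d : ℕ) (δ : ℝ) : Antitone (fun T : ℕ => opt d T δ) := by
  refine antitone_nat_of_succ_le fun T => ?_
  refine le_iInf fun R => ?_
  let R' : Reconstructor d := ⟨R.query, fun l => R.output (l.take T)⟩
  refine (iInf_le _ R').trans ?_
  refine iSup_mono fun x => iSup_mono fun A => ?_
  have h : ∀ t, transcript R' A t = transcript R A t := by
    intro t
    induction t with
    | zero => rfl
    | succ t ih => simp [transcript, ih, R']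
  have h2 : estimate R' A (T + 1) = estimate R A T := by
    have hl : ((transcript R A T).map Prod.snd).length = T := by
      simp [length_transcript]
    simp only [estimate, h]
    simp only [R', transcript, List.map_append]
    rw [List.take_append_of_le_length hl.ge, List.take_of_length_le hl.le]
  rw [h2]

/-- The limit that defines `optLimit` exists. -/
theorem tendsto_opt (d : ℕ) (δ : ℝ) :
    Tendsto (fun T : ℕ => opt d T δ) atTop (𝓝 (optLimit d δ)) :=
  tendsto_nhds_limUnder ⟨_, tendsto_atTop_iInf (opt_antitone d δ)⟩

end LinearReconstruction

namespace LinearReconstruction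

/-! ### Nets of the unit sphere by volume comparison -/

section Net

variable {E : Type*} [NormedAddCommGroup E] [NormedSpace ℝ E] [FiniteDimensional ℝ E]

/-- Volume bound for the size of an `ε`-separated subset of the unit ball. -/
theorem card_le_of_separated {ε : ℝ} (hε : 0 < ε) (s : Finset E) (hs : ∀ c ∈ s, ‖c‖ ≤ 1)
    (h : ∀ c ∈ s, ∀ d ∈ s, c ≠ d → ε ≤ ‖c - d‖) :
    (s.card : ℝ) ≤ (1 + 2 / ε) ^ Module.finrank ℝ E := by
  borelize E
  let μ : MeasureTheory.Measure E := MeasureTheory.Measure.addHaar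
  have hr : 0 < ε / 2 := by positivity
  have hρ : 0 < 1 + ε / 2 := by positivity
  -- Disjoint balls of radius `ε / 2` fit in a ball of radius `1 + ε / 2`; the ratio of Haar volumes
  -- bounds their number.
  have D : Set.Pairwise (s : Set E) (Function.onFun Disjoint fun c => Metric.ball c (ε / 2)) := by
    rintro c hc d hd hcd
    apply Metric.ball_disjoint_ball
    rw [dist_eq_norm, add_halves]
    exact h c hc d hd hcd
  have hsub : (⋃ c ∈ s, Metric.ball c (ε / 2)) ⊆ Metric.ball (0 : E) (1 + ε / 2) := by
    refine Set.iUnion₂_subset fun x hx => Metric.ball_subset_ball' ?_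
    rw [dist_zero_right]
    linarith [hs x hx]
  have I : (s.card : ℝ≥0∞) * ENNReal.ofReal ((ε / 2) ^ Module.finrank ℝ E) * μ (Metric.ball 0 1) ≤
      ENNReal.ofReal ((1 + ε / 2) ^ Module.finrank ℝ E) * μ (Metric.ball 0 1) :=
    calc
      _ = μ (⋃ c ∈ s, Metric.ball c (ε / 2)) := by
        rw [MeasureTheory.measure_biUnion_finset D fun c _ => measurableSet_ball]
        simp only [μ.addHaar_ball_of_pos _ hr, Finset.sum_const, nsmul_eq_mul, mul_assoc]
      _ ≤ μ (Metric.ball (0 : E) (1 + ε / 2)) := MeasureTheory.measure_mono hsub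
      _ = _ := by simp only [μ.addHaar_ball_of_pos _ hρ]
  have J := (ENNReal.mul_le_mul_iff_left (Metric.measure_ball_pos _ _ zero_lt_one).ne'
    MeasureTheory.measure_ball_lt_top.ne).1 I
  have K : (s.card : ℝ) * (ε / 2) ^ Module.finrank ℝ E ≤ (1 + ε / 2) ^ Module.finrank ℝ E := by
    have := ENNReal.toReal_le_of_le_ofReal (pow_nonneg hρ.le _) J
    rwa [ENNReal.toReal_mul, ENNReal.toReal_natCast,
      ENNReal.toReal_ofReal (pow_nonneg hr.le _)] at this
  have hE : 1 + 2 / ε = (1 + ε / 2) / (ε / 2) := by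
    field_simp
    ring
  rw [hE, div_pow]
  exact (le_div_iff₀ (pow_pos hr _)).2 K

/-- The unit sphere has an `ε`-net of size at most `(1 + 2 / ε) ^ dim`. -/
theorem exists_net {ε : ℝ} (hε : 0 < ε) :
    ∃ s : Finset (Metric.sphere (0 : E) 1), (s.card : ℝ) ≤ (1 + 2 / ε) ^ Module.finrank ℝ E ∧
      ∀ u : Metric.sphere (0 : E) 1, ∃ v ∈ s, ‖(u : E) - v‖ < ε := by
  classical
  let P : Finset (Metric.sphere (0 : E) 1) → Prop := fun s =>
    ∀ c ∈ s, ∀ d ∈ s, c ≠ d → ε ≤ ‖(c : E) - d‖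
  have hP : ∀ s, P s → (s.card : ℝ) ≤ (1 + 2 / ε) ^ Module.finrank ℝ E := by
    intro s hs
    have := card_le_of_separated hε (s.map (Function.Embedding.subtype _)) (by
      intro c hc
      obtain ⟨x, -, rfl⟩ := Finset.mem_map.1 hc
      simp) (by
      intro c hc d hd hcd
      obtain ⟨x, hx, rfl⟩ := Finset.mem_map.1 hc
      obtain ⟨y, hy, rfl⟩ := Finset.mem_map.1 hd
      exact hs x hx y hy fun h => hcd (by rw [h]))
    rwa [Finset.card_map] at this
  -- The volume bound yields a separated set of maximal cardinality. It is a net, since an uncovered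
  -- point could be added to it.
  let C : Set ℕ := {n | ∃ s, P s ∧ s.card = n}
  have hne : C.Nonempty := ⟨0, ∅, by simp [P], rfl⟩
  have hbdd : BddAbove C := by
    refine ⟨⌊(1 + 2 / ε) ^ Module.finrank ℝ E⌋₊, ?_⟩
    rintro _ ⟨s, hs, rfl⟩
    exact Nat.le_floor (hP s hs)
  obtain ⟨s, hs, hcard⟩ := Nat.sSup_mem hne hbdd
  refine ⟨s, hP s hs, fun u => ?_⟩
  by_contra! hu
  have hus : u ∉ s := fun h => by
    have := hu u h
    simp only [sub_self, norm_zero] at this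
    linarith
  have hins : P (insert u s) := by
    intro c hc d hd hcd
    rcases Finset.mem_insert.1 hc with hcu | hcs <;> rcases Finset.mem_insert.1 hd with hdu | hds
    · exact absurd (hcu.trans hdu.symm) hcd
    · exact hcu ▸ hu d hds
    · rw [norm_sub_rev]
      exact hdu ▸ hu c hcs
    · exact hs c hcs d hds hcd
  have := le_csSup hbdd ⟨_, hins, rfl⟩
  rw [Finset.card_insert_of_notMem hus] at this
  omega

end Net

/-! ### Jung's theorem -/

section Jung

variable {E : Type*} [NormedAddCommGroup E] [InnerProductSpace ℝ E]

/-- Jung's theorem with the dimension-free constant, for finite families. -/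
theorem exists_center_finite {ι : Type*} [Fintype ι] [Nonempty ι] (p : ι → E) {D : ℝ}
    (hp : ∀ i j, ‖p i - p j‖ ≤ D) :
    ∃ c : E, ∀ i, ‖p i - c‖ ≤ D / √2 := by
  classical
  have hD : 0 ≤ D := (norm_nonneg _).trans (hp (Classical.arbitrary ι) (Classical.arbitrary ι))
  -- On the simplex, `f w` is the variance of the distribution `w` on the points; the barycenter of
  -- a maximizer serves as the center.
  let f : (ι → ℝ) → ℝ := fun w => ∑ i, w i * ‖p i‖ ^ 2 - ‖∑ i, w i • p i‖ ^ 2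
  have hf : Continuous f := by fun_prop
  obtain ⟨w, hw, hmax⟩ := (isCompact_stdSimplex ℝ ι).exists_isMaxOn
    ⟨_, single_mem_stdSimplex ℝ (Classical.arbitrary ι)⟩ hf.continuousOn
  let c : E := ∑ i, w i • p i
  let q : ℝ := ∑ i, w i * ‖p i‖ ^ 2
  have hfw : f w = q - ‖c‖ ^ 2 := rfl
  have hsum : ∑ i, w i = 1 := hw.2
  -- the maximal value of `f` is at most `D ^ 2 / 2`
  have hval : f w ≤ D ^ 2 / 2 := by
    have h1 : ∀ i, ∑ j, w j * ‖p i - p j‖ ^ 2 = ‖p i‖ ^ 2 - 2 * inner ℝ (p i) c + q := by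
      intro i
      have : ∀ j, w j * ‖p i - p j‖ ^ 2 =
          w j * ‖p i‖ ^ 2 - 2 * (w j * inner ℝ (p i) (p j)) + w j * ‖p j‖ ^ 2 := fun j => by
        rw [norm_sub_sq_real]; ring
      simp only [this, Finset.sum_add_distrib, Finset.sum_sub_distrib, ← Finset.sum_mul, hsum,
        ← Finset.mul_sum, c, inner_sum, inner_smul_right, q, one_mul]
    -- The mean squared distance between two independent samples is twice the variance.
    have h2 : ∑ i, w i * ∑ j, w j * ‖p i - p j‖ ^ 2 = 2 * f w := by
      have h3 : ∑ i, w i * inner ℝ (p i) c = ‖c‖ ^ 2 := by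
        rw [← real_inner_self_eq_norm_sq]
        conv_rhs => rw [show c = ∑ i, w i • p i from rfl, sum_inner]
        simp only [inner_smul_left, RCLike.conj_to_real, c]
      have : ∀ i, w i * ∑ j, w j * ‖p i - p j‖ ^ 2 =
          w i * ‖p i‖ ^ 2 - 2 * (w i * inner ℝ (p i) c) + w i * q := fun i => by
        rw [h1]; ring
      simp only [this, Finset.sum_add_distrib, Finset.sum_sub_distrib, ← Finset.sum_mul, hsum,
        ← Finset.mul_sum, h3]
      rw [hfw]
      ring
    have h4 : ∑ i, w i * ∑ j, w j * ‖p i - p j‖ ^ 2 ≤ ∑ i, w i * ∑ j, w j * D ^ 2 := by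
      gcongr with i _ j _
      · exact hw.1 i
      · exact hw.1 j
      · exact hp i j
    rw [← Finset.sum_mul, hsum, ← Finset.sum_mul, hsum] at h4
    linarith
  -- first order optimality in the direction of each vertex
  have hopt : ∀ j, ‖p j - c‖ ^ 2 ≤ f w := by
    intro j
    -- Moving mass `t` to vertex `j` changes `f` by `t * (‖p j - c‖ ^ 2 - f w) - t ^ 2 * ‖p j - c‖ ^
    -- 2`, which is nonpositive at a maximum; divide by `t` and let `t → 0`.
    have key : ∀ t : ℝ, 0 < t → t ≤ 1 → ‖p j - c‖ ^ 2 - f w ≤ t * ‖p j - c‖ ^ 2 := by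
      intro t ht ht1
      have hmem : (1 - t) • w + t • Pi.single j (1 : ℝ) ∈ stdSimplex ℝ ι :=
        convex_stdSimplex ℝ ι hw (single_mem_stdSimplex ℝ j) (by linarith) ht.le (by ring)
      have hle : f ((1 - t) • w + t • Pi.single j (1 : ℝ)) ≤ f w := hmax hmem
      have hexp : f ((1 - t) • w + t • Pi.single j (1 : ℝ)) =
          (1 - t) * q + t * ‖p j‖ ^ 2 - ‖c + t • (p j - c)‖ ^ 2 := by
        have e1 : ∑ i, ((1 - t) • w + t • Pi.single j (1 : ℝ) : ι → ℝ) i * ‖p i‖ ^ 2 =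
            (1 - t) * q + t * ‖p j‖ ^ 2 := by
          simp [add_mul, Finset.sum_add_distrib, q, Finset.mul_sum, mul_assoc, Pi.single_apply]
        have e2 : ∑ i, ((1 - t) • w + t • Pi.single j (1 : ℝ) : ι → ℝ) i • p i = c + t • (p j - c) := by
          have : c + t • (p j - c) = (1 - t) • c + t • p j := by module
          rw [this]
          simp [add_smul, Finset.sum_add_distrib, c, Finset.smul_sum, mul_smul, Pi.single_apply]
        simp only [f, e1, e2]
      rw [hexp, hfw, norm_add_sq_real, norm_smul, inner_smul_right, Real.norm_eq_abs, mul_pow,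
        sq_abs] at hle
      have hpj : ‖p j‖ ^ 2 = ‖c‖ ^ 2 + 2 * inner ℝ c (p j - c) + ‖p j - c‖ ^ 2 := by
        rw [← norm_add_sq_real, add_sub_cancel]
      rw [hfw]
      refine le_of_mul_le_mul_left ?_ ht
      nlinarith
    have hlim : Tendsto (fun t : ℝ => t * ‖p j - c‖ ^ 2) (𝓝[>] 0) (𝓝 (0 * ‖p j - c‖ ^ 2)) :=
      ((continuous_id.mul continuous_const).tendsto 0).mono_left nhdsWithin_le_nhds
    have := ge_of_tendsto hlim (b := ‖p j - c‖ ^ 2 - f w) (by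
      filter_upwards [Ioc_mem_nhdsGT (zero_lt_one' ℝ)] with t ht
      exact key t ht.1 ht.2)
    linarith
  refine ⟨c, fun j => ?_⟩
  refine abs_le_of_sq_le_sq' ?_ (by positivity) |>.2
  rw [div_pow, Real.sq_sqrt zero_le_two]
  exact (hopt j).trans hval

/-- Jung's theorem with the dimension-free constant: a set of diameter at most `D` is contained in
a closed ball of radius `D / √2`. -/
theorem exists_center [FiniteDimensional ℝ E] (K : Set E) {D : ℝ}
    (hK : ∀ x ∈ K, ∀ y ∈ K, ‖x - y‖ ≤ D) : ∃ c : E, ∀ x ∈ K, ‖c - x‖ ≤ D / √2 := by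
  classical
  have : ProperSpace E := FiniteDimensional.proper_real E
  rcases K.eq_empty_or_nonempty with rfl | ⟨x₀, hx₀⟩
  · exact ⟨0, by simp⟩
  -- Finite intersection property for the balls around points of `K`; the ball at `x₀` provides
  -- compactness, so `x₀` joins each finite subfamily.
  have := (isCompact_closedBall x₀ (D / √2)).inter_iInter_nonempty
    (fun x : K => Metric.closedBall (x : E) (D / √2)) (fun _ => Metric.isClosed_closedBall) (by
      intro u
      have : Nonempty ↥(insert (⟨x₀, hx₀⟩ : K) u) := ⟨⟨_, Finset.mem_insert_self _ _⟩⟩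
      obtain ⟨c, hc⟩ := exists_center_finite
        (fun i : ↥(insert (⟨x₀, hx₀⟩ : K) u) => ((i : K) : E)) (D := D)
        (fun i j => hK _ i.1.2 _ j.1.2)
      refine ⟨c, ?_, Set.mem_iInter₂.2 fun x hx => ?_⟩
      · rw [mem_closedBall_iff_norm']
        exact hc ⟨_, Finset.mem_insert_self _ _⟩
      · rw [mem_closedBall_iff_norm']
        exact hc ⟨x, Finset.mem_insert_of_mem hx⟩)
  obtain ⟨c, -, hc⟩ := this
  exact ⟨c, fun x hx => by simpa [dist_eq_norm] using Set.mem_iInter.1 hc ⟨x, hx⟩⟩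

end Jung

/-! ### Upper bound from a net -/

/-- A vector with small components along every direction of an `ε`-net is small. -/
theorem norm_le_of_net {E : Type*} [NormedAddCommGroup E] [InnerProductSpace ℝ E]
    {ε a : ℝ} (hε : ε < 1) (ha : 0 ≤ a)
    {s : Set (Metric.sphere (0 : E) 1)}
    (hs : ∀ u : Metric.sphere (0 : E) 1, ∃ v ∈ s, ‖(u : E) - v‖ < ε) {w : E}
    (hw : ∀ v ∈ s, |inner ℝ w (v : E)| ≤ a) : ‖w‖ ≤ a / (1 - ε) := by
  have h1 : 0 < 1 - ε := by linarith
  rcases eq_or_ne w 0 with rfl | h0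
  · rw [norm_zero]; positivity
  have hn : 0 < ‖w‖ := norm_pos_iff.2 h0
  obtain ⟨v, hv, huv⟩ := hs ⟨‖w‖⁻¹ • w, by simp [norm_smul, hn.ne']⟩
  have e1 : inner ℝ w (‖w‖⁻¹ • w) = ‖w‖ := by
    rw [inner_smul_right, real_inner_self_eq_norm_sq]
    field_simp
  have e2 : inner ℝ w (‖w‖⁻¹ • w - (v : E)) ≤ ‖w‖ * ε :=
    (real_inner_le_norm _ _).trans (by gcongr)
  rw [inner_sub_right, e1] at e2
  have e3 := (abs_le.1 (hw v hv)).2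
  rw [le_div_iff₀ h1]
  linarith

/-- Querying all directions of an `ε`-net. -/
theorem opt_le_of_net {d T : ℕ} {δ ε : ℝ} (hδ : 0 ≤ δ) (hε : ε < 1) {s : Finset (Direction d)}
    (hne : s.Nonempty) (hcard : s.card ≤ T)
    (hs : ∀ u : Direction d, ∃ v ∈ s, ‖(u : EuclideanSpace ℝ (Fin d)) - v‖ < ε) :
    opt d T δ ≤ ENNReal.ofReal (√2 * δ / (1 - ε)) := by
  classical
  obtain ⟨v₀, -⟩ := hne
  let e := s.equivFin
  -- Rounds beyond the size of the net repeat `v₀`; their answers are ignored.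
  let q : ℕ → Direction d := fun n => if h : n < s.card then e.symm ⟨n, h⟩ else v₀
  have hq : ∀ v ∈ s, ∃ n < s.card, q n = v := fun v hv =>
    ⟨e ⟨v, hv⟩, (e ⟨v, hv⟩).2, by simp [q]⟩
  let K : List ℝ → Set (EuclideanSpace ℝ (Fin d)) := fun l =>
    {x | ∀ n < s.card, |l.getD n 0 - inner ℝ x (q n : EuclideanSpace ℝ (Fin d))| ≤ δ}
  -- Two points consistent with the same answers differ by at most `2 * δ` along each net direction,
  -- which bounds the diameter for Jung's theorem.
  have hK : ∀ l, ∃ c, ∀ x ∈ K l, ‖c - x‖ ≤ (2 * δ / (1 - ε)) / √2 := by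
    refine fun l => exists_center _ fun x hx y hy => ?_
    refine norm_le_of_net hε (by positivity) (s := s) hs fun v hv => ?_
    obtain ⟨n, hn, rfl⟩ := hq v hv
    have h1 := abs_le.1 (hx n hn)
    have h2 := abs_le.1 (hy n hn)
    rw [inner_sub_left, abs_le]
    constructor <;> linarith
  choose c hc using hK
  let R : Reconstructor d := ⟨fun l => q l.length, c⟩
  refine (iInf_le _ R).trans (iSup_le fun x => iSup_le fun A => ?_)
  have htr : ∀ t, ∀ n < t, |((transcript R A t).map Prod.snd).getD n 0 -
      inner ℝ x (q n : EuclideanSpace ℝ (Fin d))| ≤ δ := by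
    intro t
    induction t with
    | zero => simp
    | succ t ih =>
      intro n hn
      simp only [transcript, List.map_append, List.map_cons, List.map_nil]
      rcases Nat.lt_succ_iff_lt_or_eq.1 hn with h | rfl
      · rw [List.getD_append _ _ _ _ (by simpa [length_transcript] using h)]
        exact ih n h
      · rw [List.getD_append_right _ _ _ _ (by simp [length_transcript])]
        simpa [length_transcript, R] using A.accurate (transcript R A n) (q n)
  have hx : x ∈ K ((transcript R A T).map Prod.snd) := fun n hn => htr T n (hn.trans_le hcard)
  rw [← ofReal_norm]
  refine ENNReal.ofReal_le_ofReal ((hc _ x hx).trans_eq ?_)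
  rw [div_div, mul_comm (1 - ε), ← div_div]
  congr 1
  rw [div_eq_iff (by positivity)]
  nlinarith [Real.mul_self_sqrt (zero_le_two (α := ℝ))]

instance direction_nonempty {d : ℕ} [NeZero d] : Nonempty (Direction d) :=
  ⟨⟨EuclideanSpace.single 0 1, by simp⟩⟩

theorem opt_le_of_budget {d T : ℕ} [NeZero d] {δ ε : ℝ} (hδ : 0 ≤ δ) (hε0 : 0 < ε) (hε : ε < 1)
    (hT : (1 + 2 / ε) ^ d ≤ (T : ℝ)) : opt d T δ ≤ ENNReal.ofReal (√2 * δ / (1 - ε)) := by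
  obtain ⟨s, hcard, hs⟩ := exists_net (E := EuclideanSpace ℝ (Fin d)) hε0
  rw [finrank_euclideanSpace_fin] at hcard
  obtain ⟨v, hv, -⟩ := hs (Classical.arbitrary _)
  exact opt_le_of_net hδ hε ⟨v, hv⟩ (by exact_mod_cast hcard.trans hT) hs

theorem optLimit_le_opt (d T : ℕ) (δ : ℝ) : optLimit d δ ≤ opt d T δ :=
  (opt_antitone d δ).le_of_tendsto (tendsto_opt d δ) T

/-- The crude choice `ε = 1 / 2` suffices: what matters is a finite bound independent of `d`. -/
theorem optLimit_le {d : ℕ} [NeZero d] {δ : ℝ} (hδ : 0 ≤ δ) :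
    optLimit d δ ≤ ENNReal.ofReal (2 * √2 * δ) := by
  obtain ⟨T, hT⟩ := exists_nat_ge ((1 + 2 / (1 / 2 : ℝ)) ^ d)
  refine (optLimit_le_opt d T δ).trans ((opt_le_of_budget hδ (by norm_num) (by norm_num) hT).trans ?_)
  exact ENNReal.ofReal_le_ofReal (by ring_nf; rfl)

/-! ### Lower bound from a regular simplex -/

section LowerBound

variable {d : ℕ} {δ : ℝ}

/-- The adversary whose answers depend on the query only. -/
def obliviousAdversary (a : Direction d → ℝ) (x : EuclideanSpace ℝ (Fin d))
    (ha : ∀ v : Direction d, |a v - inner ℝ x (v : EuclideanSpace ℝ (Fin d))| ≤ δ) :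
    Adversary d δ x :=
  ⟨fun _ v => a v, fun _ v => ha v⟩

theorem transcript_obliviousAdversary_eq (R : Reconstructor d) {a : Direction d → ℝ}
    {x y : EuclideanSpace ℝ (Fin d)}
    (hx : ∀ v : Direction d, |a v - inner ℝ x (v : EuclideanSpace ℝ (Fin d))| ≤ δ)
    (hy : ∀ v : Direction d, |a v - inner ℝ y (v : EuclideanSpace ℝ (Fin d))| ≤ δ) (t : ℕ) :
    transcript R (obliviousAdversary a x hx) t = transcript R (obliviousAdversary a y hy) t := by
  induction t with
  | zero => rfl
  | succ t ih =>
    simp only [transcript, ih]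
    rfl

/-- If a family of points is consistent with the same answers to all directions, then the
reconstruction error is at least `r` whenever no open ball of radius `r` contains the family. -/
theorem le_opt_of_points {ι : Type*} [Nonempty ι] (T : ℕ) (p : ι → EuclideanSpace ℝ (Fin d))
    (a : Direction d → ℝ)
    (ha : ∀ i (v : Direction d), |a v - inner ℝ (p i) (v : EuclideanSpace ℝ (Fin d))| ≤ δ) {r : ℝ}
    (hr : ∀ c : EuclideanSpace ℝ (Fin d), ∃ i, r ≤ ‖c - p i‖) :
    ENNReal.ofReal r ≤ opt d T δ := by
  refine le_iInf fun R => ?_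
  let i₀ : ι := Classical.arbitrary ι
  obtain ⟨i, hi⟩ := hr (estimate R (obliviousAdversary a (p i₀) (ha i₀)) T)
  refine le_iSup_of_le (p i) (le_iSup_of_le (obliviousAdversary a (p i) (ha i)) ?_)
  rw [← ofReal_norm]
  refine ENNReal.ofReal_le_ofReal ?_
  rwa [estimate, transcript_obliviousAdversary_eq R (ha i) (ha i₀)]

/-- Two coordinates of a unit vector differ by at most `√2`, so the vertices `√2 * δ * e_i` project
into an interval of length `2 * δ`, whose midpoint (or that of the actual projections) is accurate
for all of them. The bound is the circumradius of this simplex. -/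
theorem le_opt_simplex [NeZero d] (hδ : 0 ≤ δ) (T : ℕ) :
    ENNReal.ofReal (√2 * δ * √(1 - 1 / d)) ≤ opt d T δ := by
  have hd : (0 : ℝ) < d := by exact_mod_cast Nat.pos_of_ne_zero (NeZero.ne d)
  have h2 : √2 * √2 = (2 : ℝ) := Real.mul_self_sqrt zero_le_two
  have hspread : ∀ (v : Direction d) (i j : Fin d),
      (v : EuclideanSpace ℝ (Fin d)) i - (v : EuclideanSpace ℝ (Fin d)) j ≤ √2 := by
    intro v i j
    rcases eq_or_ne i j with rfl | hij
    · simp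
    have hv : ∑ k, (v : EuclideanSpace ℝ (Fin d)) k ^ 2 = 1 := by
      rw [← EuclideanSpace.real_norm_sq_eq]
      simp
    have hle : (v : EuclideanSpace ℝ (Fin d)) i ^ 2 + (v : EuclideanSpace ℝ (Fin d)) j ^ 2 ≤ 1 := by
      refine le_of_le_of_eq ?_ hv
      rw [← Finset.sum_pair hij (f := fun k => (v : EuclideanSpace ℝ (Fin d)) k ^ 2)]
      exact Finset.sum_le_sum_of_subset_of_nonneg (Finset.subset_univ _)
        fun _ _ _ => sq_nonneg _
    refine Real.le_sqrt_of_sq_le ?_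
    nlinarith [sq_nonneg ((v : EuclideanSpace ℝ (Fin d)) i + (v : EuclideanSpace ℝ (Fin d)) j)]
  let hi : Direction d → ℝ := fun v =>
    Finset.univ.sup' Finset.univ_nonempty fun i : Fin d => (v : EuclideanSpace ℝ (Fin d)) i
  let lo : Direction d → ℝ := fun v =>
    Finset.univ.inf' Finset.univ_nonempty fun i : Fin d => (v : EuclideanSpace ℝ (Fin d)) i
  refine le_opt_of_points T (fun i : Fin d => EuclideanSpace.single i (√2 * δ))
    (fun v => √2 * δ * ((hi v + lo v) / 2)) (fun i v => ?_) (fun c => ?_)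
  · have h1 : (v : EuclideanSpace ℝ (Fin d)) i ≤ hi v :=
      Finset.le_sup' (fun i : Fin d => (v : EuclideanSpace ℝ (Fin d)) i) (Finset.mem_univ i)
    have h3 : lo v ≤ (v : EuclideanSpace ℝ (Fin d)) i :=
      Finset.inf'_le (fun i : Fin d => (v : EuclideanSpace ℝ (Fin d)) i) (Finset.mem_univ i)
    have h4 : hi v - lo v ≤ √2 := by
      obtain ⟨k, -, hk⟩ := Finset.exists_mem_eq_sup' Finset.univ_nonempty
        fun i : Fin d => (v : EuclideanSpace ℝ (Fin d)) i
      obtain ⟨l, -, hl⟩ := Finset.exists_mem_eq_inf' Finset.univ_nonempty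
        fun i : Fin d => (v : EuclideanSpace ℝ (Fin d)) i
      simp only [hi, lo, hk, hl]
      exact hspread v k l
    have h5 : |(hi v + lo v) / 2 - (v : EuclideanSpace ℝ (Fin d)) i| ≤ √2 / 2 := by
      rw [abs_le]
      constructor <;> linarith
    have h6 : inner ℝ (EuclideanSpace.single i (√2 * δ)) (v : EuclideanSpace ℝ (Fin d)) =
        √2 * δ * (v : EuclideanSpace ℝ (Fin d)) i := by
      simp [EuclideanSpace.inner_single_left]
    rw [h6, ← mul_sub, abs_mul, abs_of_nonneg (by positivity)]
    calc √2 * δ * |(hi v + lo v) / 2 - (v : EuclideanSpace ℝ (Fin d)) i|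
        ≤ √2 * δ * (√2 / 2) := by gcongr
      _ = δ * (√2 * √2) / 2 := by ring
      _ = δ := by rw [h2]; ring
  · by_contra! hlt
    let m : ℝ := √2 * δ
    have hm : 0 ≤ m := by positivity
    have hd1 : (1 : ℝ) ≤ d := by exact_mod_cast Nat.pos_of_ne_zero (NeZero.ne d)
    have hrad : (0 : ℝ) ≤ 1 - 1 / d := by
      rw [sub_nonneg, div_le_one hd]
      exact hd1
    have hsq : ∀ i : Fin d, ‖c‖ ^ 2 - 2 * (m * c i) + m ^ 2 < m ^ 2 * (1 - 1 / d) := by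
      intro i
      have e : ‖c - EuclideanSpace.single i m‖ ^ 2 = ‖c‖ ^ 2 - 2 * (m * c i) + m ^ 2 := by
        rw [norm_sub_sq_real]
        simp [EuclideanSpace.inner_single_right]
      rw [← e, ← Real.sq_sqrt hrad, ← mul_pow]
      exact pow_lt_pow_left₀ (hlt i) (norm_nonneg _) two_ne_zero
    -- Summing over the vertices and using Cauchy–Schwarz for `∑ i, c i` would give `(∑ i, c i - m)
    -- ^ 2 < 0`.
    have hsum : ∑ i : Fin d, (‖c‖ ^ 2 - 2 * (m * c i) + m ^ 2) <
        ∑ _i : Fin d, m ^ 2 * (1 - 1 / (d : ℝ)) :=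
      Finset.sum_lt_sum_of_nonempty Finset.univ_nonempty fun i _ => hsq i
    simp only [Finset.sum_add_distrib, Finset.sum_sub_distrib, Finset.sum_const, Finset.card_univ,
      Fintype.card_fin, nsmul_eq_mul, ← Finset.mul_sum] at hsum
    have hcs : (∑ i, c i) ^ 2 ≤ d * ‖c‖ ^ 2 := by
      rw [EuclideanSpace.real_norm_sq_eq]
      simpa using sq_sum_le_card_mul_sum_sq (s := Finset.univ) (f := fun i : Fin d => c i)
    have hfin : (d : ℝ) * (m ^ 2 * (1 - 1 / d)) = d * m ^ 2 - m ^ 2 := by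
      field_simp
    rw [hfin] at hsum
    nlinarith [sq_nonneg (∑ i, c i - m)]

theorem le_optLimit [NeZero d] (hδ : 0 ≤ δ) :
    ENNReal.ofReal (√2 * δ * √(1 - 1 / d)) ≤ optLimit d δ :=
  ge_of_tendsto' (tendsto_opt d δ) fun T => le_opt_simplex hδ T

end LowerBound

/-! ### Random signs against subexponential budgets -/

section SubexponentialBudget

/-- Exponential moments of a Rademacher sum. -/
theorem sum_exp_rademacher_le {ι : Type*} [Fintype ι] [DecidableEq ι] (b : ι → ℝ) :
    ∑ σ : ι → Bool, Real.exp (∑ i, (if σ i then b i else -b i)) ≤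
      2 ^ Fintype.card ι * Real.exp ((∑ i, b i ^ 2) / 2) := by
  have h : ∑ σ : ι → Bool, Real.exp (∑ i, (if σ i then b i else -b i)) =
      ∏ i, ∑ s : Bool, Real.exp (if s then b i else -b i) := by
    rw [Finset.prod_univ_sum, Fintype.piFinset_univ]
    simp only [Real.exp_sum]
  rw [h]
  calc ∏ i, ∑ s : Bool, Real.exp (if s then b i else -b i)
      ≤ ∏ i, 2 * Real.exp (b i ^ 2 / 2) := by
        refine Finset.prod_le_prod (fun i _ => Finset.sum_nonneg fun _ _ => (Real.exp_pos _).le)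
          fun i _ => ?_
        have := Real.cosh_le_exp_half_sq (b i)
        rw [Real.cosh_eq] at this
        simp only [Fintype.sum_bool, if_true, Bool.false_eq_true, if_false]
        linarith
    _ = _ := by
        rw [Finset.prod_mul_distrib, Finset.prod_const, Finset.card_univ, ← Real.exp_sum,
          Finset.sum_div]

/-- Hoeffding's inequality for Rademacher sums, as a counting statement. -/
theorem card_rademacher_le {ι : Type*} [Fintype ι] [DecidableEq ι] {b : ι → ℝ}
    (hb : ∑ i, b i ^ 2 = 1) {s : ℝ} (hs : 0 ≤ s) :
    ((Finset.univ.filter fun σ : ι → Bool => s < |∑ i, (if σ i then b i else -b i)|).card : ℝ) ≤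
      2 ^ Fintype.card ι * (2 * Real.exp (-(s ^ 2 / 2))) := by
  let X : (ι → Bool) → ℝ := fun σ => ∑ i, (if σ i then b i else -b i)
  -- Chernoff's method: for the tail at `s`, the exponent `u ^ 2 / 2 - u * s` is least at `u = s`;
  -- `u = -s` treats the other tail.
  have hmoment : ∀ u : ℝ, u ^ 2 = s ^ 2 →
      ∑ σ, Real.exp (u * X σ) ≤ 2 ^ Fintype.card ι * Real.exp (s ^ 2 / 2) := by
    intro u hu
    have := sum_exp_rademacher_le fun i => u * b i
    simp only [mul_pow, ← Finset.mul_sum, hb, mul_one, hu] at this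
    refine le_of_eq_of_le (Finset.sum_congr rfl fun σ _ => ?_) this
    congr 1
    rw [Finset.mul_sum]
    refine Finset.sum_congr rfl fun i _ => ?_
    split_ifs <;> ring
  have h1 : ((Finset.univ.filter fun σ => s < |X σ|).card : ℝ) * Real.exp (s ^ 2) ≤
      ∑ σ, (Real.exp (s * X σ) + Real.exp (-s * X σ)) := by
    rw [← nsmul_eq_mul, ← Finset.sum_const]
    refine (Finset.sum_le_sum fun σ hσ => ?_).trans
      (Finset.sum_le_sum_of_subset_of_nonneg (Finset.filter_subset _ _) fun σ _ _ => by positivity)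
    have hσ' := (Finset.mem_filter.1 hσ).2
    rcases lt_abs.1 hσ' with h | h
    · have : Real.exp (s ^ 2) ≤ Real.exp (s * X σ) := Real.exp_le_exp.2 (by nlinarith)
      linarith [Real.exp_pos (-s * X σ)]
    · have : Real.exp (s ^ 2) ≤ Real.exp (-s * X σ) := Real.exp_le_exp.2 (by nlinarith)
      linarith [Real.exp_pos (s * X σ)]
  rw [Finset.sum_add_distrib] at h1
  have h2 := h1.trans (add_le_add (hmoment s rfl) (hmoment (-s) (by ring)))
  have hpos := Real.exp_pos (s ^ 2)
  rw [← le_div_iff₀ hpos] at h2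
  refine h2.trans_eq ?_
  have he : Real.exp (-(s ^ 2 / 2)) = Real.exp (s ^ 2 / 2) / Real.exp (s ^ 2) := by
    rw [← Real.exp_sub]; congr 1; ring
  rw [he]
  ring

/-- Fewer than exponentially many slabs of width `2 * δ` contain a common point of norm `M`. -/
theorem exists_almost_orthogonal {d T : ℕ} [NeZero d] {δ M : ℝ} (hδ : 0 ≤ δ) (hM : 0 < M)
    (hT : (T : ℝ) * (2 * Real.exp (-(d * δ ^ 2 / M ^ 2 / 2))) < 1) (v : Fin T → Direction d) :
    ∃ x : EuclideanSpace ℝ (Fin d), ‖x‖ = M ∧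
      ∀ t, |inner ℝ x (v t : EuclideanSpace ℝ (Fin d))| ≤ δ := by
  classical
  have hd : (0 : ℝ) < d := by exact_mod_cast Nat.pos_of_ne_zero (NeZero.ne d)
  have hsd : 0 < √(d : ℝ) := Real.sqrt_pos.2 hd
  -- The witness will be `M / √d` times a sign vector, so the sign sums may be as large as `s`
  -- before the inner products exceed `δ`.
  let s : ℝ := √d * δ / M
  have hs : s ^ 2 = d * δ ^ 2 / M ^ 2 := by
    simp only [s, div_pow, mul_pow, Real.sq_sqrt hd.le]
  let X : Fin T → (Fin d → Bool) → ℝ := fun t σ =>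
    ∑ i, (if σ i then (v t : EuclideanSpace ℝ (Fin d)) i else -(v t : EuclideanSpace ℝ (Fin d)) i)
  -- Union bound: the bad sign patterns of the `T` directions together number fewer than `2 ^ d`.
  obtain ⟨σ, hσ⟩ : ∃ σ, ∀ t, |X t σ| ≤ s := by
    by_contra! hcon
    have hcover : (Finset.univ : Finset (Fin d → Bool)) ⊆
        Finset.univ.biUnion fun t => Finset.univ.filter fun σ => s < |X t σ| := by
      intro σ _
      obtain ⟨t, ht⟩ := hcon σ
      simpa using ⟨t, ht⟩
    have hcard := (Finset.card_le_card hcover).trans Finset.card_biUnion_le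
    have hcard' : (2 : ℝ) ^ d ≤ ∑ t, ((Finset.univ.filter fun σ => s < |X t σ|).card : ℝ) := by
      have := (Nat.cast_le (α := ℝ)).2 hcard
      simpa using this
    have hbound : ∀ t, ((Finset.univ.filter fun σ => s < |X t σ|).card : ℝ) ≤
        2 ^ d * (2 * Real.exp (-(d * δ ^ 2 / M ^ 2 / 2))) := by
      intro t
      have := card_rademacher_le (b := fun i => (v t : EuclideanSpace ℝ (Fin d)) i) (s := s)
        (by rw [← EuclideanSpace.real_norm_sq_eq]; simp) (by positivity)
      rwa [Fintype.card_fin, hs] at this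
    have := hcard'.trans (Finset.sum_le_sum fun t _ => hbound t)
    rw [Finset.sum_const, Finset.card_univ, Fintype.card_fin, nsmul_eq_mul] at this
    have h2 : (0 : ℝ) < 2 ^ d := by positivity
    nlinarith
  refine ⟨WithLp.toLp 2 fun i => if σ i then M / √d else -(M / √d), ?_, fun t => ?_⟩
  · rw [← sq_eq_sq₀ (norm_nonneg _) hM.le, EuclideanSpace.real_norm_sq_eq]
    have : ∀ i, (if σ i then M / √d else -(M / √d)) ^ 2 = M ^ 2 / d := fun i => by
      split_ifs <;> simp [div_pow, Real.sq_sqrt hd.le]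
    simp only [this, Finset.sum_const, Finset.card_univ, Fintype.card_fin, nsmul_eq_mul]
    field_simp
  · have e : inner ℝ (WithLp.toLp 2 fun i => if σ i then M / √d else -(M / √d))
        (v t : EuclideanSpace ℝ (Fin d)) = M / √d * X t σ := by
      rw [PiLp.inner_apply, Finset.mul_sum]
      refine Finset.sum_congr rfl fun i _ => ?_
      simp only [RCLike.inner_apply, conj_trivial]
      split_ifs <;> ring
    rw [e, abs_mul, abs_of_pos (by positivity)]
    calc M / √d * |X t σ| ≤ M / √d * s := by gcongr; exact hσ t
      _ = δ := by simp only [s]; field_simp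

/-- While all answers are zero, the adaptive queries are a fixed sequence, so the secret can be
chosen after them. Both `x` and `-x` then permit zero answers throughout, and since they are `2 * M`
apart, any estimate misses one of them by at least `M`. -/
theorem le_opt_of_subexponential {d T : ℕ} [NeZero d] {δ M : ℝ} (hδ : 0 ≤ δ) (hM : 0 < M)
    (hT : (T : ℝ) * (2 * Real.exp (-(d * δ ^ 2 / M ^ 2 / 2))) < 1) :
    ENNReal.ofReal M ≤ opt d T δ := by
  classical
  refine le_iInf fun R => ?_
  let q : ℕ → Direction d := fun t => R.query (List.replicate t 0)
  obtain ⟨x, hx, hxq⟩ := exists_almost_orthogonal hδ hM hT fun t : Fin T => q t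
  -- the adversary answers zero whenever this is accurate
  let A : ∀ y : EuclideanSpace ℝ (Fin d), Adversary d δ y := fun y =>
    ⟨fun _ v => if |inner ℝ y (v : EuclideanSpace ℝ (Fin d))| ≤ δ then 0 else inner ℝ y v.1,
      fun _ v => by split_ifs with h <;> simpa⟩
  have htr : ∀ y : EuclideanSpace ℝ (Fin d),
      (∀ t : Fin T, |inner ℝ y (q t : EuclideanSpace ℝ (Fin d))| ≤ δ) →
      estimate R (A y) T = R.output (List.replicate T 0) := by
    intro y hy
    have : ∀ t ≤ T, (transcript R (A y) t).map Prod.snd = List.replicate t 0 := by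
      intro t
      induction t with
      | zero => simp [transcript]
      | succ t ih =>
        intro ht
        have h := hy ⟨t, ht⟩
        simp only [q] at h
        simp only [transcript, List.map_append, List.map_cons, List.map_nil,
          ih (Nat.le_of_succ_le ht), A, List.replicate_succ', if_pos h]
    rw [estimate, this T le_rfl]
  let c := R.output (List.replicate T 0)
  have hfar : M ≤ ‖c - x‖ ∨ M ≤ ‖c - -x‖ := by
    by_contra! h
    have := norm_sub_le (c - -x) (c - x)
    rw [show c - -x - (c - x) = (2 : ℝ) • x by module, norm_smul, hx] at this
    norm_num at this
    linarith [h.1, sub_neg_eq_add c x ▸ h.2]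
  have hneg : ∀ t : Fin T, |inner ℝ (-x) (q t : EuclideanSpace ℝ (Fin d))| ≤ δ := fun t => by
    rw [inner_neg_left, abs_neg]
    exact hxq t
  have hle : ∀ y, (∀ t : Fin T, |inner ℝ y (q t : EuclideanSpace ℝ (Fin d))| ≤ δ) →
      M ≤ ‖c - y‖ → ENNReal.ofReal M ≤ ⨆ x : EuclideanSpace ℝ (Fin d), ⨆ A : Adversary d δ x,
        ‖estimate R A T - x‖ₑ := by
    intro y hy hMy
    refine le_iSup_of_le y (le_iSup_of_le (A y) ?_)
    rw [htr y hy, ← ofReal_norm]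
    exact ENNReal.ofReal_le_ofReal hMy
  rcases hfar with h | h
  · exact hle x hxq h
  · exact hle (-x) hneg h

end SubexponentialBudget

/-! ### Excess error in the two regimes -/

theorem coe_sub_coe_le_excessErr {d T : ℕ} {δ a b : ℝ} (hb : 0 ≤ b)
    (h1 : ENNReal.ofReal a ≤ opt d T δ) (h2 : optLimit d δ ≤ ENNReal.ofReal b) :
    ((a - b : ℝ) : EReal) ≤ excessErr d T δ := by
  rw [excessErr, EReal.coe_sub]
  refine EReal.sub_le_sub ?_ ?_
  · refine le_trans ?_ (EReal.coe_ennreal_le_coe_ennreal_iff.2 h1)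
    rw [EReal.coe_ennreal_ofReal]
    exact_mod_cast le_max_left a 0
  · refine (EReal.coe_ennreal_le_coe_ennreal_iff.2 h2).trans ?_
    rw [EReal.coe_ennreal_ofReal, max_eq_left hb]

theorem excessErr_le_coe_sub_coe {d T : ℕ} {δ a b : ℝ} (ha : 0 ≤ a)
    (h1 : opt d T δ ≤ ENNReal.ofReal a) (h2 : ENNReal.ofReal b ≤ optLimit d δ) :
    excessErr d T δ ≤ ((a - b : ℝ) : EReal) := by
  rw [excessErr, EReal.coe_sub]
  refine EReal.sub_le_sub ?_ ?_
  · refine (EReal.coe_ennreal_le_coe_ennreal_iff.2 h1).trans ?_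
    rw [EReal.coe_ennreal_ofReal, max_eq_left ha]
  · refine le_trans ?_ (EReal.coe_ennreal_le_coe_ennreal_iff.2 h2)
    rw [EReal.coe_ennreal_ofReal]
    exact_mod_cast le_max_left b 0

theorem excessErr_nonneg {d T : ℕ} [NeZero d] {δ : ℝ} (hδ : 0 ≤ δ) : 0 ≤ excessErr d T δ := by
  -- Finiteness of the limit is essential: in `EReal`, `⊤ - ⊤` is `⊥`.
  have hfin : (optLimit d δ : EReal) ≠ ⊤ := by
    rw [Ne, EReal.coe_ennreal_eq_top_iff]
    exact ((optLimit_le hδ).trans_lt ENNReal.ofReal_lt_top).ne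
  rw [excessErr, EReal.sub_nonneg (Or.inr hfin) (Or.inr (EReal.coe_ennreal_ne_bot _))]
  exact EReal.coe_ennreal_le_coe_ennreal_iff.2 (optLimit_le_opt d T δ)

theorem tendsto_excessErr_top {δ : ℝ} (hδ : 0 < δ) {T : ℕ → ℕ}
    (hT : Tendsto (fun d : ℕ => Real.log (T d : ℝ) / (d : ℝ)) atTop (𝓝 0)) :
    Tendsto (fun d : ℕ => excessErr d (T d) δ) atTop (𝓝 (⊤ : EReal)) := by
  rw [EReal.tendsto_nhds_top_iff_real]
  intro a
  -- Chosen so that `M` minus the bound `2 * √2 * δ` on the limit still exceeds `a`.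
  let M : ℝ := |a| + 1 + 2 * √2 * δ
  have hM : 0 < M := by positivity
  let κ : ℝ := δ ^ 2 / M ^ 2 / 2
  have hκ : 0 < κ := by positivity
  have hlin : Tendsto (fun d : ℕ => κ / 2 * (d : ℝ)) atTop atTop :=
    tendsto_natCast_atTop_atTop.const_mul_atTop (by positivity)
  -- The exponential gain `κ * d` is split in half: one half absorbs `log (T d)`, the other the
  -- factor `2`.
  filter_upwards [hT.eventually_lt_const (half_pos hκ), eventually_gt_atTop 0,
    hlin.eventually_gt_atTop (Real.log 2)] with d hlog hd0 hd2
  have : NeZero d := ⟨hd0.ne'⟩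
  have hd : (0 : ℝ) < d := by exact_mod_cast hd0
  have hsmall : (T d : ℝ) * (2 * Real.exp (-(d * δ ^ 2 / M ^ 2 / 2))) < 1 := by
    rcases Nat.eq_zero_or_pos (T d) with h0 | h0
    · simp [h0]
    have hT0 : (0 : ℝ) < T d := by exact_mod_cast h0
    rw [div_lt_iff₀ hd] at hlog
    have : (d : ℝ) * δ ^ 2 / M ^ 2 / 2 = κ * d := by simp only [κ]; ring
    rw [this, ← Real.exp_log hT0, ← Real.exp_log (zero_lt_two' ℝ), ← Real.exp_add,
      ← Real.exp_add, Real.exp_lt_one_iff]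
    linarith
  refine lt_of_lt_of_le ?_ (coe_sub_coe_le_excessErr (by positivity)
    (le_opt_of_subexponential hδ.le hM hsmall) (optLimit_le hδ.le))
  have : a < M - 2 * √2 * δ := by
    simp only [M]
    linarith [le_abs_self a]
  exact_mod_cast this

theorem tendsto_excessErr_zero {δ : ℝ} (hδ : 0 < δ) {T : ℕ → ℕ}
    (hT : Tendsto (fun d : ℕ => Real.log (T d : ℝ) / (d : ℝ)) atTop atTop) :
    Tendsto (fun d : ℕ => excessErr d (T d) δ) atTop (𝓝 (0 : EReal)) := by
  have hupper : ∀ η : ℝ, 0 < η → ∀ᶠ d : ℕ in atTop, excessErr d (T d) δ < (η : EReal) := by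
    intro η hη
    have hcont : Tendsto (fun ε : ℝ => √2 * δ / (1 - ε)) (𝓝[>] 0) (𝓝 (√2 * δ / (1 - 0))) := by
      refine Tendsto.mono_left ?_ nhdsWithin_le_nhds
      exact tendsto_const_nhds.div (tendsto_const_nhds.sub tendsto_id) (by norm_num)
    rw [sub_zero, div_one] at hcont
    -- The tolerance `η` is shared: half for the loss from `ε`, half for the gap between the simplex
    -- bound and `√2 * δ`.
    obtain ⟨ε, hεη, hε0, hε1⟩ := ((hcont.eventually_lt_const
      (show √2 * δ < √2 * δ + η / 2 by linarith)).and
        (Ioo_mem_nhdsGT (zero_lt_one' ℝ))).exists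
    have hroot : Tendsto (fun d : ℕ => √2 * δ * √(1 - 1 / (d : ℝ))) atTop (𝓝 (√2 * δ)) := by
      have h := (tendsto_const_nhds (x := (1 : ℝ))).sub tendsto_one_div_atTop_nhds_zero_nat
      have := ((Real.continuous_sqrt.tendsto _).comp h).const_mul (√2 * δ)
      simpa using this
    filter_upwards [hroot.eventually_const_lt (show √2 * δ - η / 2 < √2 * δ by linarith),
      eventually_gt_atTop 0, hT.eventually_ge_atTop (Real.log (1 + 2 / ε)),
      hT.eventually_gt_atTop 0] with d hd1 hd0 hlog hpos
    have : NeZero d := ⟨hd0.ne'⟩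
    have hd : (0 : ℝ) < d := by exact_mod_cast hd0
    -- Positivity of the ratio rules out `T d = 0`, where `Real.log` takes the value `0`.
    have hT0 : (0 : ℝ) < T d := by
      rcases Nat.eq_zero_or_pos (T d) with h0 | h0
      · simp [h0] at hpos
      · exact_mod_cast h0
    have hbudget : (1 + 2 / ε) ^ d ≤ (T d : ℝ) := by
      rw [← Real.log_le_log_iff (by positivity) hT0, Real.log_pow, mul_comm]
      exact (le_div_iff₀ hd).1 hlog
    have h1ε : 0 < 1 - ε := by linarith
    refine (excessErr_le_coe_sub_coe (by positivity) (opt_le_of_budget hδ.le hε0 hε1 hbudget)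
      (le_optLimit hδ.le)).trans_lt ?_
    exact_mod_cast (by linarith :
      √2 * δ / (1 - ε) - √2 * δ * √(1 - 1 / (d : ℝ)) < η)
  refine tendsto_order.2 ⟨fun a ha => ?_, fun a ha => ?_⟩
  · filter_upwards [eventually_gt_atTop 0] with d hd0
    have : NeZero d := ⟨hd0.ne'⟩
    exact ha.trans_le (excessErr_nonneg hδ.le)
  · obtain ⟨η, hη0, hηa⟩ := EReal.lt_iff_exists_real_btwn.1 ha
    filter_upwards [hupper η (by exact_mod_cast hη0)] with d hd
    exact hd.trans hηa

end LinearReconstruction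

theorem theorem3 (δ : ℝ) (hδ : 0 < δ) (T : ℕ → ℕ) :
    (Tendsto (fun d : ℕ => Real.log (T d : ℝ) / (d : ℝ)) atTop (𝓝 0) →
      Tendsto (fun d : ℕ => LinearReconstruction.excessErr d (T d) δ) atTop (𝓝 (⊤ : EReal))) ∧
    (Tendsto (fun d : ℕ => Real.log (T d : ℝ) / (d : ℝ)) atTop atTop →
      Tendsto (fun d : ℕ => LinearReconstruction.excessErr d (T d) δ) atTop (𝓝 (0 : EReal))) :=
  ⟨LinearReconstruction.tendsto_excessErr_top hδ, LinearReconstruction.tendsto_excessErr_zero hδ⟩
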